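/- For positive integers $k<N$ and $\mu,\sigma>0$, the pair $(S,E)$ is drawn under the model $\text{2-WSBM}(\mu,\sigma,N,k)$ if $S$ is a uniformly random $k$-element subset of $\{1,\dots,N\}$ and, conditionally on $S$, the weights $E_{ij}$ of the edges $\{i,j\}$, $i\neq j$, of the complete graph on $\{1,\dots,N\}$ are independent with $E_{ij}\sim\mathcal N(\mu,\sigma^2)$ if $i,j\in S$ and $E_{ij}\sim\mathcal N(0,\sigma^2)$ otherwise. For a sequence of such models, exact recovery is solvable if there are measurable functions $\hat S=\hat S_N(E)$ of the weights with $\mathbb P[S=\hat S(E)]\to 1$ as $N\to\infty$, and unsolvable otherwise. Theorem. For each $N$ let $\hat\mu=\hat\mu_N>0$, $\hat\sigma=\hat\sigma_N>0$ and $\gamma=\gamma_N=\hat\mu_N/\hat\sigma_N$ (constants are allowed), and let $k=k_N$ be integers with $2\le k<N$ for all large $N$. Consider the models $\text{2-WSBM}\big(\hat\mu\log N,\ \hat\sigma\sqrt{\tfrac{\log N}{2}},\ N,\ k\big)$. 1. If $\gamma<\gamma_-:=\sqrt{\frac1{k-1}}$ for all large $N$, then exact recovery is unsolvable. 2. If $\gamma>\gamma_+$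 for all large $N$, then exact recovery is solvable, in each of the following regimes, where $$\gamma_+=\begin{cases}2\sqrt{\frac{1}{k-1}} & \text{if } k=o(\log N),\\[2pt] 2\sqrt{\frac{1+\log 2+\frac1c}{\log N}} & \text{if } \frac{k}{\log N}\to c,\ c\in(0,+\infty],\ \text{with } \tfrac1c=0 \text{ for } c=+\infty,\\[2pt] 2\sqrt{\frac{1+\log 2}{(1-\alpha)\log N}} & \text{if } \frac{k}{\log N}\to\infty \text{ and } k\le N^{\alpha+o(1)},\ 0<\alpha<1.\end{cases}$$ -/

import Mathlib

open MeasureTheory ProbabilityTheory Filter Topology Asymptotics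

noncomputable section

namespace WSBM

/-- The edges of the complete graph on the `N` nodes `Fin N` (unordered pairs of distinct nodes). -/
abbrev Edge (N : ℕ) : Type := (⊤ : SimpleGraph (Fin N)).edgeSet

/-- A weighting of all the edges of the complete graph on `N` nodes. -/
abbrev Weights (N : ℕ) : Type := Edge N → ℝ

/-- The conditional law of the edge weights given the community `S`: the weights are independent,
an edge with both endpoints in `S` has law `𝒩(μ, σ²)`, any other edge has law `𝒩(0, σ²)`. -/
def weightLaw (μ σ : ℝ) (N : ℕ) (S : Finset (Fin N)) : Measure (Weights N) :=
  Measure.pi fun e : Edge N =>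
    gaussianReal (if ∀ v ∈ (e : Sym2 (Fin N)), v ∈ S then μ else 0) (Real.toNNReal (σ ^ 2))

/-- The joint law of the pair `(S, E)` in the 2-WSBM with parameters `(μ, σ, N, k)`: the community
`S` is uniform among the `k`-element sets of nodes, and given `S` the weights `E` have law
`weightLaw μ σ N S`. -/
def law (μ σ : ℝ) (N k : ℕ) : Measure (Finset (Fin N) × Weights N) :=
  ∑ S ∈ Finset.powersetCard k (Finset.univ : Finset (Fin N)),
    ((N.choose k : ENNReal)⁻¹) • (weightLaw μ σ N S).map (fun E => (S, E))

/-- Exact recovery is achieved in the sequence of models 2-WSBM`(μ N, σ N, N, k N)`: some sequence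
of (measurable) estimators of the community from the weights alone satisfies
`ℙ[S = Ŝ(E)] = 1 - o(1)` as `N → ∞`. -/
def ExactRecovery (μ σ : ℕ → ℝ) (k : ℕ → ℕ) : Prop :=
  ∃ Shat : (N : ℕ) → Weights N → Finset (Fin N),
    (∀ N, Measurable (Shat N)) ∧
      Tendsto (fun N => law (μ N) (σ N) N (k N) {p | p.1 = Shat N p.2}) atTop (𝓝 1)

/-- Exact recovery in the 2-WSBM with the scaled parameters
`(μ̂ log N, σ̂ √(log N / 2), N, k)`, where `μ̂`, `σ̂` and `k` may vary with `N`. -/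
def Solvable (muhat sigmahat : ℕ → ℝ) (k : ℕ → ℕ) : Prop :=
  ExactRecovery (fun N => muhat N * Real.log N)
    (fun N => sigmahat N * Real.sqrt (Real.log N / 2)) k

end WSBM

end

namespace WSBM

/-! Impossibility. Deleting one node from `S`, or adding one, moves the means of only `k - 1` or `k`
edges, so the log-likelihood ratio between the two laws is Gaussian with variance `a ^ 2`, about `2
(k - 1) γ ^ 2 log N`. Outside an event of probability `1 - gaussianTail`, an event under `S` costs
at most the factor `exp (a ^ 2 / 2 - a)` under the neighbour (`pi_gaussianReal_real_le`). A single
neighbour is shared by `N - k + 1` sets `S` (deletion) or `k + 1` sets (addition), and an estimator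
can name only one of them. Double counting (`sum_le_of_regular`) keeps the success probability away
from 1 as long as that factor is a small multiple of `N`, which `(k - 1) γ ^ 2 < 1` ensures; the
better of the two neighbours is used according to whether `2 k ≤ N`.

Recovery. The estimator returns the heaviest `k`-set. If `S'` is at least as heavy as `S`, then
either the `n` edges lost from `S` weigh at most `3/4` of their mean `n m`, or the `n` edges gained
weigh at least `3/4 n m`. The first event depends only on `D = S \ S'`, so its union bound runs over
subsets of `S` and pays no factor `N`; the second pays `N ^ |D|` but has an exponent nine times
larger. Hence `k exp (-q) → 0` and `k N exp (-9 q) → 0` suffice, where `q = (k - 1) γ ^ 2 log N /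
32` (`solvable_of_tendsto`). Each regime then reduces to a lower bound, 4 or 64, on `(k - 1) γ ^ 2`.
-/

/-! ### Gaussian vectors: linear forms, tails and change of measure. -/

theorem map_sum_mul_pi_gaussianReal {ι : Type*} [Fintype ι] (u w : ι → ℝ) (V : NNReal) :
    (Measure.pi fun i => gaussianReal (u i) V).map (fun x => ∑ i, w i * x i) =
      gaussianReal (∑ i, w i * u i) (Real.toNNReal (V * ∑ i, w i ^ 2)) := by
  have hind : iIndepFun (fun i (x : ι → ℝ) => w i * x i)
      (Measure.pi fun i => gaussianReal (u i) V) :=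
    iIndepFun_pi (X := fun i (y : ℝ) => w i * y) (fun i => (measurable_const_mul (w i)).aemeasurable)
  refine Measure.ext_of_charFun ?_
  have h1 := hind.charFun_map_fun_sum_eq_prod
    (fun i => ((measurable_pi_apply i).const_mul (w i)).aemeasurable)
  rw [h1]
  ext t
  rw [Finset.prod_apply, charFun_gaussianReal]
  have h2 : ∀ i, (Measure.pi fun i => gaussianReal (u i) V).map (fun x => w i * x i) =
      gaussianReal (w i * u i) (NNReal.mk (w i ^ 2) (sq_nonneg _) * V) := by
    intro i
    rw [← gaussianReal_map_const_mul, ← (measurePreserving_eval (fun i => gaussianReal (u i) V) i).map_eq,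
      Measure.map_map (by fun_prop) (by fun_prop)]
    rfl
  simp only [h2, charFun_gaussianReal, ← Complex.exp_sum]
  congr 1
  have h3 : ((Real.toNNReal (V * ∑ i, w i ^ 2) : NNReal) : ℝ) = V * ∑ i, w i ^ 2 :=
    Real.coe_toNNReal _ (by positivity)
  rw [Finset.sum_sub_distrib]
  have h4 : (((Real.toNNReal (V * ∑ i, w i ^ 2) : NNReal) : ℝ) : ℂ) = V * ∑ i, (w i : ℂ) ^ 2 := by
    rw [h3]; push_cast; rfl
  rw [h4]
  push_cast
  simp only [Finset.mul_sum, Finset.sum_mul, Finset.sum_div]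
  congr 1
  refine Finset.sum_congr rfl fun i _ => ?_
  ring

/-- Chernoff's bound at the optimal parameter `t = s / v`. -/
theorem gaussianReal_real_Ici_add_le (m s : ℝ) (hs : 0 ≤ s) {v : NNReal} (hv : v ≠ 0) :
    (gaussianReal m v).real (Set.Ici (m + s)) ≤ Real.exp (-s ^ 2 / (2 * v)) := by
  have hv' : (0 : ℝ) < v := by positivity
  have h := measure_ge_le_exp_mul_mgf (μ := gaussianReal m v) (X := id) (t := s / v) (m + s)
    (by positivity) (integrable_exp_mul_gaussianReal _)
  rw [mgf_id_gaussianReal, ← Real.exp_add] at h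
  refine h.trans (Real.exp_le_exp.2 (le_of_eq ?_))
  field_simp
  ring

theorem gaussianReal_real_Iic_sub_le (m s : ℝ) (hs : 0 ≤ s) {v : NNReal} (hv : v ≠ 0) :
    (gaussianReal m v).real (Set.Iic (m - s)) ≤ Real.exp (-s ^ 2 / (2 * v)) := by
  have hv' : (0 : ℝ) < v := by positivity
  have h := measure_le_le_exp_mul_mgf (μ := gaussianReal m v) (X := id) (t := -(s / v)) (m - s)
    (by have : 0 ≤ s / v := by positivity
        linarith) (integrable_exp_mul_gaussianReal _)
  rw [mgf_id_gaussianReal, ← Real.exp_add] at h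
  refine h.trans (Real.exp_le_exp.2 (le_of_eq ?_))
  field_simp
  ring

theorem pi_withDensity {ι : Type*} [Fintype ι] {α : ι → Type*} [∀ i, MeasurableSpace (α i)]
    (μ : ∀ i, Measure (α i)) [∀ i, IsProbabilityMeasure (μ i)] (f : ∀ i, α i → ENNReal)
    (hf : ∀ i, Measurable (f i)) [∀ i, SigmaFinite ((μ i).withDensity (f i))] :
    Measure.pi (fun i => (μ i).withDensity (f i)) =
      (Measure.pi μ).withDensity (fun x => ∏ i, f i (x i)) := by
  refine Measure.pi_eq fun s hs => ?_
  rw [withDensity_apply _ (MeasurableSet.univ_pi hs), ← lintegral_indicator (MeasurableSet.univ_pi hs)]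
  have hind : iIndepFun (fun i (x : ∀ i, α i) => (s i).indicator (f i) (x i)) (Measure.pi μ) :=
    iIndepFun_pi (X := fun i (y : α i) => (s i).indicator (f i) y)
      (fun i => ((hf i).indicator (hs i)).aemeasurable)
  have h := lintegral_prod_eq_prod_lintegral_of_indepFun Finset.univ _ hind
    (fun i => ((hf i).indicator (hs i)).comp (measurable_pi_apply i))
  have e : (Set.univ.pi s).indicator (fun x => ∏ i, f i (x i)) =
      fun x => ∏ i, (s i).indicator (f i) (x i) := by
    ext x
    by_cases hx : x ∈ Set.univ.pi s
    · rw [Set.indicator_of_mem hx]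
      exact Finset.prod_congr rfl fun i _ => (Set.indicator_of_mem (hx i trivial) _).symm
    · rw [Set.indicator_of_notMem hx]
      simp only [Set.mem_pi, Set.mem_univ, true_imp_iff, not_forall] at hx
      obtain ⟨i, hi⟩ := hx
      exact (Finset.prod_eq_zero (Finset.mem_univ i) (Set.indicator_of_notMem hi _)).symm
  rw [e, h]
  refine Finset.prod_congr rfl fun i _ => ?_
  rw [withDensity_apply _ (hs i), ← lintegral_indicator (hs i)]
  have := (measurePreserving_eval μ i).lintegral_comp ((hf i).indicator (hs i))
  exact this

/-- The exponent is centred at `u`, so that its linear part has mean zero under the law on the left.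
-/
theorem gaussianReal_eq_withDensity (u v : ℝ) {V : NNReal} (hV : V ≠ 0) :
    gaussianReal u V = (gaussianReal v V).withDensity fun x =>
      ENNReal.ofReal (Real.exp ((u - v) * (x - u) / V + (u - v) ^ 2 / (2 * V))) := by
  have hV' : (0 : ℝ) < V := by positivity
  rw [gaussianReal_of_var_ne_zero _ hV, gaussianReal_of_var_ne_zero _ hV,
    ← withDensity_mul _ (measurable_gaussianPDF _ _) (by fun_prop)]
  congr 1
  ext x
  rw [Pi.mul_apply, gaussianPDF, gaussianPDF, ← ENNReal.ofReal_mul (gaussianPDFReal_nonneg _ _ _),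
    gaussianPDFReal, gaussianPDFReal, mul_assoc (_⁻¹), ← Real.exp_add]
  congr 3
  field_simp
  ring

theorem pi_gaussianReal_eq_withDensity {ι : Type*} [Fintype ι] (u v : ι → ℝ) {V : NNReal}
    (hV : V ≠ 0) :
    (Measure.pi fun i => gaussianReal (u i) V) =
      (Measure.pi fun i => gaussianReal (v i) V).withDensity fun x =>
        ENNReal.ofReal (Real.exp ((∑ i, (u i - v i) * (x i - u i)) / V +
          (∑ i, (u i - v i) ^ 2) / (2 * V))) := by
  have e : ∀ i, gaussianReal (u i) V = (gaussianReal (v i) V).withDensity fun x =>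
      ENNReal.ofReal (Real.exp ((u i - v i) * (x - u i) / V + (u i - v i) ^ 2 / (2 * V))) :=
    fun i => gaussianReal_eq_withDensity _ _ hV
  have : ∀ i, SigmaFinite ((gaussianReal (v i) V).withDensity fun x =>
      ENNReal.ofReal (Real.exp ((u i - v i) * (x - u i) / V + (u i - v i) ^ 2 / (2 * V)))) :=
    fun i => by rw [← e i]; infer_instance
  conv_lhs => rw [funext e]
  rw [pi_withDensity _ _ (fun i => by fun_prop)]
  congr 1
  ext x
  rw [← ENNReal.ofReal_prod_of_nonneg (fun i _ => (Real.exp_pos _).le), ← Real.exp_sum,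
    Finset.sum_add_distrib, Finset.sum_div, Finset.sum_div]

/-- The standard Gaussian probability of lying at least one standard deviation below the mean. -/
noncomputable def gaussianTail : ℝ := (gaussianReal 0 1).real (Set.Iic (-1))

theorem gaussianTail_pos : 0 < gaussianTail := by
  rw [gaussianTail, measureReal_def, ENNReal.toReal_pos_iff]
  refine ⟨?_, measure_lt_top _ _⟩
  rw [pos_iff_ne_zero]
  intro h
  have := gaussianReal_absolutelyContinuous' 0 (one_ne_zero : (1 : NNReal) ≠ 0) h
  simp at this

theorem gaussianReal_real_Iic_neg_sqrt {v : NNReal} (hv : v ≠ 0) :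
    (gaussianReal 0 v).real (Set.Iic (-Real.sqrt v)) = gaussianTail := by
  have hs : 0 < Real.sqrt v := Real.sqrt_pos.2 (by positivity)
  have h := gaussianReal_map_const_mul (μ := 0) (v := 1) (Real.sqrt v)
  have e : NNReal.mk (Real.sqrt v ^ 2) (sq_nonneg _) * 1 = v := by
    ext; rw [mul_one, NNReal.coe_mk, Real.sq_sqrt (NNReal.coe_nonneg v)]
  rw [e, mul_zero] at h
  rw [← h, gaussianTail, map_measureReal_apply (by fun_prop) measurableSet_Iic]
  congr 1
  ext x
  simp only [Set.mem_preimage, Set.mem_Iic]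
  constructor <;> intro hx <;> nlinarith

/-- Under the first law the log-likelihood ratio is `𝒩(a ^ 2 / 2, a ^ 2)`. With probability
`gaussianTail` it falls a standard deviation `a` below its mean, and there the density is at most
`exp (a ^ 2 / 2 - a) ≤ t`. The gain `exp (-a)` is what reaches the threshold, where `exp (a ^ 2 /
2)` alone can be of order `N`. -/
theorem pi_gaussianReal_real_le {ι : Type*} [Fintype ι] (u v : ι → ℝ) {V : NNReal} (hV : V ≠ 0)
    {a t : ℝ} (ha : 0 < a) (h : ∑ i, (u i - v i) ^ 2 = a ^ 2 * V)
    (ht : Real.exp (a ^ 2 / 2 - a) ≤ t) {A : Set (ι → ℝ)} (hA : MeasurableSet A) :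
    (Measure.pi fun i => gaussianReal (u i) V).real A ≤
      1 - gaussianTail + t * (Measure.pi fun i => gaussianReal (v i) V).real A := by
  set P := Measure.pi fun i => gaussianReal (u i) V with hP
  set Q := Measure.pi fun i => gaussianReal (v i) V with hQ
  have hV' : (0 : ℝ) < V := by positivity
  set Z : (ι → ℝ) → ℝ := fun x => ∑ i, (u i - v i) * (x i - u i) with hZ
  have hZm : Measurable Z := by fun_prop
  -- `Z` is the centred log-likelihood ratio times `V`; its standard deviation under `P` is `a * V`.
  set B : Set (ι → ℝ) := {x | Z x ≤ -(a * V)} with hB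
  have hBm : MeasurableSet B := measurableSet_le hZm measurable_const
  have hZlaw : P.map (fun x => Z x) = gaussianReal 0 (Real.toNNReal (V * (a ^ 2 * V))) := by
    have e : (fun x => Z x) = (fun y => y - ∑ i, (u i - v i) * u i) ∘
        (fun x : ι → ℝ => ∑ i, (u i - v i) * x i) := by
      ext x
      simp [hZ, mul_sub, Finset.sum_sub_distrib]
    rw [e, ← Measure.map_map (by fun_prop) (by fun_prop), hP, map_sum_mul_pi_gaussianReal,
      gaussianReal_map_sub_const, h, sub_self]
  have hPB : P.real B = gaussianTail := by
    have hne : Real.toNNReal (V * (a ^ 2 * V)) ≠ 0 := by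
      simp only [ne_eq, Real.toNNReal_eq_zero, not_le]; positivity
    rw [← gaussianReal_real_Iic_neg_sqrt hne, ← hZlaw, map_measureReal_apply hZm measurableSet_Iic,
      Real.coe_toNNReal _ (by positivity)]
    have : Real.sqrt (V * (a ^ 2 * V)) = a * V := by
      rw [show (V : ℝ) * (a ^ 2 * V) = (a * V) ^ 2 by ring, Real.sqrt_sq (by positivity)]
    rw [this]; rfl
  have h1 : P.real A ≤ P.real Bᶜ + P.real (A ∩ B) := by
    refine (measureReal_mono (s₂ := Bᶜ ∪ (A ∩ B)) ?_).trans (measureReal_union_le _ _)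
    intro x hx
    by_cases hxB : x ∈ B
    · exact Or.inr ⟨hx, hxB⟩
    · exact Or.inl hxB
  have ht0 : 0 < t := (Real.exp_pos _).trans_le ht
  have h2 : P (A ∩ B) ≤ ENNReal.ofReal t * Q A := by
    rw [hP, pi_gaussianReal_eq_withDensity u v hV, ← hQ, withDensity_apply _ (hA.inter hBm)]
    calc _ ≤ ∫⁻ _ in A ∩ B, ENNReal.ofReal t ∂Q := by
          refine setLIntegral_mono (by fun_prop) fun x hx => ENNReal.ofReal_le_ofReal ?_
          refine (Real.exp_le_exp.2 ?_).trans ht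
          have hxB : Z x ≤ -(a * V) := hx.2
          have e1 : Z x / V ≤ -a := by rw [div_le_iff₀ hV']; linarith
          have e2 : (∑ i, (u i - v i) ^ 2) / (2 * V) = a ^ 2 / 2 := by
            rw [h]; field_simp
          rw [e2]
          change Z x / V + _ ≤ _
          linarith
      _ = ENNReal.ofReal t * Q (A ∩ B) := by rw [setLIntegral_const]
      _ ≤ _ := by gcongr; exact Set.inter_subset_left
  have h3 : P.real (A ∩ B) ≤ t * Q.real A := by
    have := ENNReal.toReal_mono (by finiteness) h2
    rwa [ENNReal.toReal_mul, ENNReal.toReal_ofReal ht0.le] at this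
  rw [probReal_compl_eq_one_sub hBm, hPB] at h1
  linarith

/-! ### Edges inside a community and comparison of nested communities. -/

/-- The edges with both endpoints in `S`. -/
def edgesIn {N : ℕ} (S : Finset (Fin N)) : Finset (Edge N) :=
  Finset.univ.filter fun e => ∀ v ∈ (e : Sym2 (Fin N)), v ∈ S

theorem mem_edgesIn {N : ℕ} {S : Finset (Fin N)} {e : Edge N} :
    e ∈ edgesIn S ↔ ∀ v ∈ (e : Sym2 (Fin N)), v ∈ S := by
  simp [edgesIn]

theorem edgesIn_mono {N : ℕ} {S T : Finset (Fin N)} (h : S ⊆ T) : edgesIn S ⊆ edgesIn T :=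
  fun _ he => mem_edgesIn.2 fun v hv => h (mem_edgesIn.1 he v hv)

theorem edgesIn_inter {N : ℕ} (S T : Finset (Fin N)) :
    edgesIn (S ∩ T) = edgesIn S ∩ edgesIn T := by
  ext e
  simp only [mem_edgesIn, Finset.mem_inter]
  exact ⟨fun h => ⟨fun v hv => (h v hv).1, fun v hv => (h v hv).2⟩,
    fun h v hv => ⟨h.1 v hv, h.2 v hv⟩⟩

theorem card_edgesIn {N : ℕ} (S : Finset (Fin N)) : (edgesIn S).card = S.card.choose 2 := by
  rw [← Sym2.card_image_offDiag S, ← Finset.card_map (Function.Embedding.subtype _)]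
  congr 1
  ext e
  induction e using Sym2.ind with
  | _ x y =>
    simp only [Finset.mem_map, mem_edgesIn, Finset.mem_image, Finset.mem_offDiag, Prod.exists,
      Function.Embedding.subtype_apply, Subtype.exists, exists_and_left, exists_prop,
      exists_eq_right_right]
    constructor
    · rintro ⟨h, hxy⟩
      have hne : x ≠ y := by simpa using hxy
      exact ⟨x, y, ⟨h x (by simp), h y (by simp), hne⟩, rfl⟩
    · rintro ⟨a, b, ⟨ha, hb, hab⟩, h⟩
      rw [← h]
      refine ⟨fun v hv => ?_, by simpa using hab⟩
      rcases Sym2.mem_iff.1 hv with rfl | rfl <;> assumption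

instance instIsProbabilityMeasureWeightLaw (μ σ : ℝ) (N : ℕ) (S : Finset (Fin N)) :
    IsProbabilityMeasure (weightLaw μ σ N S) := by
  unfold weightLaw; infer_instance

theorem sum_sq_mean_sub {N : ℕ} (m : ℝ) {S T : Finset (Fin N)} (h : T ⊆ S) :
    ∑ e : Edge N, ((if ∀ v ∈ (e : Sym2 (Fin N)), v ∈ S then m else 0) -
      (if ∀ v ∈ (e : Sym2 (Fin N)), v ∈ T then m else 0)) ^ 2 =
      m ^ 2 * ((S.card.choose 2 : ℝ) - T.card.choose 2) := by
  have e1 : ∀ e : Edge N, ((if ∀ v ∈ (e : Sym2 (Fin N)), v ∈ S then m else 0) -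
      (if ∀ v ∈ (e : Sym2 (Fin N)), v ∈ T then m else 0)) ^ 2 =
      if e ∈ edgesIn S \ edgesIn T then m ^ 2 else 0 := by
    intro e
    simp only [Finset.mem_sdiff, ← mem_edgesIn]
    by_cases h1 : e ∈ edgesIn T
    · simp [h1, edgesIn_mono h h1]
    · by_cases h2 : e ∈ edgesIn S <;> simp [h1, h2]
  rw [Finset.sum_congr rfl fun e _ => e1 e, Finset.sum_ite_mem, Finset.univ_inter,
    Finset.sum_const, nsmul_eq_mul, Finset.cast_card_sdiff (edgesIn_mono h), card_edgesIn,
    card_edgesIn, mul_comm]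

theorem weightLaw_real_le {N : ℕ} {m σ : ℝ} (hm : 0 < m) (hσ : 0 < σ) {S T : Finset (Fin N)}
    {n : ℕ}
    (h : (T ⊆ S ∧ S.card.choose 2 = T.card.choose 2 + n) ∨
      (S ⊆ T ∧ T.card.choose 2 = S.card.choose 2 + n))
    {a t : ℝ} (ha0 : 0 < a) (ha : a ^ 2 = n * (m / σ) ^ 2) (ht : Real.exp (a ^ 2 / 2 - a) ≤ t)
    {A : Set (Weights N)} (hA : MeasurableSet A) :
    (weightLaw m σ N S).real A ≤ 1 - gaussianTail + t * (weightLaw m σ N T).real A := by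
  have hV : Real.toNNReal (σ ^ 2) ≠ 0 := by
    simp only [ne_eq, Real.toNNReal_eq_zero, not_le]; positivity
  refine pi_gaussianReal_real_le _ _ hV ha0 ?_ ht hA
  rw [Real.coe_toNNReal _ (by positivity), ha]
  rcases h with ⟨h, hc⟩ | ⟨h, hc⟩
  · rw [sum_sq_mean_sub m h, hc]
    push_cast
    field_simp
    ring
  · have := sum_sq_mean_sub m h
    rw [hc] at this
    rw [Finset.sum_congr rfl fun e _ => sub_sq_comm _ _, this]
    push_cast
    field_simp
    ring

/-! ### Success probability and the impossibility bound. -/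

theorem law_success {μ σ : ℝ} {N k : ℕ} {f : Weights N → Finset (Fin N)} (hf : Measurable f) :
    law μ σ N k {p | p.1 = f p.2} = ∑ S ∈ Finset.powersetCard k (Finset.univ : Finset (Fin N)),
      (N.choose k : ENNReal)⁻¹ * weightLaw μ σ N S (f ⁻¹' {S}) := by
  rw [law, Measure.finsetSum_apply]
  refine Finset.sum_congr rfl fun S _ => ?_
  rw [Measure.smul_apply, smul_eq_mul, Measure.map_apply (by fun_prop)]
  · congr 2
    ext E
    simp [eq_comm]
  · exact measurableSet_eq_fun measurable_fst (hf.comp measurable_snd)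

theorem law_success_toReal {μ σ : ℝ} {N k : ℕ} {f : Weights N → Finset (Fin N)}
    (hf : Measurable f) :
    (law μ σ N k {p | p.1 = f p.2}).toReal =
      (∑ S ∈ Finset.powersetCard k (Finset.univ : Finset (Fin N)),
        (weightLaw μ σ N S).real (f ⁻¹' {S})) / N.choose k := by
  rw [law_success hf]
  rcases Nat.eq_zero_or_pos (N.choose k) with h | h
  · have : Finset.powersetCard k (Finset.univ : Finset (Fin N)) = ∅ := by
      rw [← Finset.card_eq_zero]; simpa using h
    simp [this]
  · rw [ENNReal.toReal_sum, Finset.sum_div]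
    · refine Finset.sum_congr rfl fun S _ => ?_
      rw [ENNReal.toReal_mul, ENNReal.toReal_inv, ENNReal.toReal_natCast, measureReal_def]
      field_simp
    · intro S _
      have : (N.choose k : ENNReal)⁻¹ ≠ ⊤ := by simp; omega
      finiteness

/-- Double counting: the bound on `p S` is summed over the `d` neighbours `T` of each `S`, then the
sums are exchanged. In the application `q T S` is the probability of answering `S` under community
`T`, so its sum over `S` is at most 1. -/
theorem sum_le_of_regular {α : Type*} (𝒮 𝒯 : Finset α) (r : α → α → Prop) [DecidableRel r]
    (d : ℕ) (hd : ∀ S ∈ 𝒮, (𝒯.filter (r S)).card = d) (p : α → ℝ) (q : α → α → ℝ) {b t : ℝ}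
    (ht : 0 ≤ t) (hq0 : ∀ T S, 0 ≤ q T S) (hq : ∀ T ∈ 𝒯, ∑ S ∈ 𝒮, q T S ≤ 1)
    (hp : ∀ S ∈ 𝒮, ∀ T ∈ 𝒯, r S T → p S ≤ b + t * q T S) :
    d * ∑ S ∈ 𝒮, p S ≤ d * 𝒮.card * b + t * 𝒯.card := by
  calc d * ∑ S ∈ 𝒮, p S = ∑ S ∈ 𝒮, ∑ T ∈ 𝒯 with r S T, p S := by
        rw [Finset.mul_sum]
        refine Finset.sum_congr rfl fun S hS => ?_
        rw [Finset.sum_const, hd S hS, nsmul_eq_mul]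
    _ ≤ ∑ S ∈ 𝒮, ∑ T ∈ 𝒯 with r S T, (b + t * q T S) := by
        refine Finset.sum_le_sum fun S hS => Finset.sum_le_sum fun T hT => ?_
        rw [Finset.mem_filter] at hT
        exact hp S hS T hT.1 hT.2
    _ = d * 𝒮.card * b + ∑ S ∈ 𝒮, ∑ T ∈ 𝒯 with r S T, t * q T S := by
        simp only [Finset.sum_add_distrib]
        have e : ∀ S ∈ 𝒮, (∑ T ∈ 𝒯 with r S T, b) = d * b := fun S hS => by
          rw [Finset.sum_const, hd S hS, nsmul_eq_mul]
        rw [Finset.sum_congr rfl e, Finset.sum_const, nsmul_eq_mul]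
        ring
    _ ≤ d * 𝒮.card * b + ∑ S ∈ 𝒮, ∑ T ∈ 𝒯, t * q T S := by
        refine add_le_add le_rfl (Finset.sum_le_sum fun S _ => ?_)
        exact Finset.sum_le_sum_of_subset_of_nonneg (Finset.filter_subset _ _)
          fun T _ _ => mul_nonneg ht (hq0 T S)
    _ ≤ d * 𝒮.card * b + ∑ T ∈ 𝒯, t * 1 := by
        rw [Finset.sum_comm]
        gcongr with T hT
        rw [← Finset.mul_sum]
        exact mul_le_mul_of_nonneg_left (hq T hT) ht
    _ = _ := by simp [mul_comm]

theorem sum_real_preimage_singleton_le {Ω α : Type*} [MeasurableSpace Ω] [MeasurableSpace α]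
    [MeasurableSingletonClass α] (P : Measure Ω) [IsProbabilityMeasure P] {f : Ω → α}
    (hf : Measurable f) (s : Finset α) : ∑ a ∈ s, P.real (f ⁻¹' {a}) ≤ 1 := by
  rw [sum_measureReal_preimage_singleton _ fun a _ => hf (measurableSet_singleton a)]
  exact measureReal_le_one

theorem card_filter_subset_powersetCard {N k : ℕ} (hk : 1 ≤ k) {S : Finset (Fin N)}
    (hS : S.card = k) :
    ((Finset.powersetCard (k - 1) (Finset.univ : Finset (Fin N))).filter (fun T => T ⊆ S)).card = k := by
  have : (Finset.powersetCard (k - 1) (Finset.univ : Finset (Fin N))).filter (fun T => T ⊆ S) =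
      Finset.powersetCard (k - 1) S := by
    ext T
    simp [Finset.mem_powersetCard, and_comm]
  rw [this, Finset.card_powersetCard, hS]
  obtain ⟨j, rfl⟩ := Nat.exists_eq_add_of_le' hk
  simp

theorem card_filter_superset_powersetCard {N k : ℕ} {S : Finset (Fin N)}
    (hS : S.card = k) :
    ((Finset.powersetCard (k + 1) (Finset.univ : Finset (Fin N))).filter (fun T => S ⊆ T)).card =
      N - k := by
  have : (Finset.powersetCard (k + 1) (Finset.univ : Finset (Fin N))).filter (fun T => S ⊆ T) =
      Sᶜ.image (fun i => insert i S) := by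
    ext T
    simp only [Finset.mem_filter, Finset.mem_powersetCard, Finset.subset_univ, true_and,
      Finset.mem_image, Finset.mem_compl]
    constructor
    · rintro ⟨hT, hST⟩
      have h1 : (T \ S).card = 1 := by rw [Finset.card_sdiff_of_subset hST]; omega
      obtain ⟨i, hi⟩ := Finset.card_eq_one.1 h1
      have hi' : i ∈ T \ S := by simp [hi]
      refine ⟨i, (Finset.mem_sdiff.1 hi').2, ?_⟩
      rw [← Finset.sdiff_union_of_subset hST, hi]; rfl
    · rintro ⟨i, hi, rfl⟩
      exact ⟨by rw [Finset.card_insert_of_notMem hi, hS], Finset.subset_insert _ _⟩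
  rw [this, Finset.card_image_of_injOn, Finset.card_compl, hS, Fintype.card_fin]
  intro i hi j hj hij
  have : i ∈ insert j S := by
    have hij' : insert i S = insert j S := hij
    rw [← hij']; simp
  rcases Finset.mem_insert.1 this with h | h
  · exact h
  · simp at hi; exact absurd h hi

/-- Comparison with `S` minus a node; the denominator comes from `C(N, k) k = C(N, k - 1) (N - k +
1)`. Useful when `N - k` is of order `N`. -/
theorem success_le_of_small {N k : ℕ} (hk : 2 ≤ k) (hkN : k < N) {m σ : ℝ} (hm : 0 < m)
    (hσ : 0 < σ) {f : Weights N → Finset (Fin N)} (hf : Measurable f) {a t : ℝ} (ha0 : 0 < a)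
    (ha : a ^ 2 = ((k : ℝ) - 1) * (m / σ) ^ 2) (ht : Real.exp (a ^ 2 / 2 - a) ≤ t) :
    (law m σ N k {p | p.1 = f p.2}).toReal ≤ 1 - gaussianTail + t / (N - k + 1) := by
  have ht0 : 0 < t := (Real.exp_pos _).trans_le ht
  have h := sum_le_of_regular (Finset.powersetCard k (Finset.univ : Finset (Fin N)))
    (Finset.powersetCard (k - 1) (Finset.univ : Finset (Fin N))) (fun S T => T ⊆ S) k
    (fun S hS => card_filter_subset_powersetCard (by omega) (Finset.mem_powersetCard.1 hS).2)
    (fun S => (weightLaw m σ N S).real (f ⁻¹' {S}))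
    (fun T S => (weightLaw m σ N T).real (f ⁻¹' {S})) (b := 1 - gaussianTail) ht0.le
    (fun _ _ => measureReal_nonneg)
    (fun T _ => sum_real_preimage_singleton_le _ hf _) (by
      intro S hS T hT hTS
      refine weightLaw_real_le (n := k - 1) hm hσ (Or.inl ⟨hTS, ?_⟩) ha0 ?_ ht
        (hf (measurableSet_singleton _))
      · rw [(Finset.mem_powersetCard.1 hS).2, (Finset.mem_powersetCard.1 hT).2]
        obtain ⟨j, rfl⟩ := Nat.exists_eq_add_of_le' hk
        simp [Nat.choose_succ_succ' (j + 1) 1, add_comm]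
      · rw [ha, Nat.cast_sub (by omega)]; simp)
  rw [law_success_toReal hf]
  rw [Finset.card_powersetCard, Finset.card_powersetCard, Finset.card_univ, Fintype.card_fin] at h
  have hC : 0 < N.choose k := Nat.choose_pos hkN.le
  have hid : (N.choose k : ℝ) * k = N.choose (k - 1) * (N - k + 1) := by
    have := Nat.choose_succ_right_eq N (k - 1)
    rw [Nat.sub_add_cancel (by omega : 1 ≤ k), show N - (k - 1) = N - k + 1 by omega] at this
    have h2 := congrArg (Nat.cast (R := ℝ)) this
    push_cast [Nat.cast_sub hkN.le] at h2
    exact h2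
  have hC' : (0 : ℝ) < N.choose k := by exact_mod_cast hC
  have hD : (0 : ℝ) < (N : ℝ) - k + 1 := by
    have : (k : ℝ) < N := by exact_mod_cast hkN
    linarith
  have hk0 : (0 : ℝ) < k := by positivity
  have hid' : (N.choose (k - 1) : ℝ) = N.choose k * k / (N - k + 1) := by
    rw [eq_div_iff hD.ne', hid]
  rw [hid'] at h
  rw [div_le_iff₀ hC']
  refine le_of_mul_le_mul_left (h.trans (le_of_eq ?_)) hk0
  field_simp

/-- Comparison with `S` plus a node, useful when `k` is of order `N`. -/
theorem success_le_of_large {N k : ℕ} (hk : 2 ≤ k) (hkN : k < N) {m σ : ℝ} (hm : 0 < m)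
    (hσ : 0 < σ) {f : Weights N → Finset (Fin N)} (hf : Measurable f) {a t : ℝ} (ha0 : 0 < a)
    (ha : a ^ 2 = (k : ℝ) * (m / σ) ^ 2) (ht : Real.exp (a ^ 2 / 2 - a) ≤ t) :
    (law m σ N k {p | p.1 = f p.2}).toReal ≤ 1 - gaussianTail + t / (k + 1) := by
  have ht0 : 0 < t := (Real.exp_pos _).trans_le ht
  have h := sum_le_of_regular (Finset.powersetCard k (Finset.univ : Finset (Fin N)))
    (Finset.powersetCard (k + 1) (Finset.univ : Finset (Fin N))) (fun S T => S ⊆ T) (N - k)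
    (fun S hS => card_filter_superset_powersetCard (Finset.mem_powersetCard.1 hS).2)
    (fun S => (weightLaw m σ N S).real (f ⁻¹' {S}))
    (fun T S => (weightLaw m σ N T).real (f ⁻¹' {S})) (b := 1 - gaussianTail) ht0.le
    (fun _ _ => measureReal_nonneg)
    (fun T _ => sum_real_preimage_singleton_le _ hf _) (by
      intro S hS T hT hST
      refine weightLaw_real_le (n := k) hm hσ (Or.inr ⟨hST, ?_⟩) ha0 ha ht
        (hf (measurableSet_singleton _))
      rw [(Finset.mem_powersetCard.1 hS).2, (Finset.mem_powersetCard.1 hT).2]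
      simp [Nat.choose_succ_succ' k 1, add_comm])
  rw [law_success_toReal hf]
  rw [Finset.card_powersetCard, Finset.card_powersetCard, Finset.card_univ, Fintype.card_fin,
    Nat.cast_sub hkN.le] at h
  have hC : 0 < N.choose k := Nat.choose_pos hkN.le
  have hC' : (0 : ℝ) < N.choose k := by exact_mod_cast hC
  have hD : (0 : ℝ) < (N : ℝ) - k := by
    have : (k : ℝ) < N := by exact_mod_cast hkN
    linarith
  have hid : (N.choose (k + 1) : ℝ) = N.choose k * (N - k) / (k + 1) := by
    have h2 := congrArg (Nat.cast (R := ℝ)) (Nat.choose_succ_right_eq N k)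
    push_cast [Nat.cast_sub hkN.le] at h2
    rw [eq_div_iff (by positivity), h2]
  rw [hid] at h
  rw [div_le_iff₀ hC']
  refine le_of_mul_le_mul_left (h.trans (le_of_eq ?_)) hD
  field_simp

theorem sq_scaled_ratio {x y L : ℝ} (hL : 0 < L) :
    (x * L / (y * Real.sqrt (L / 2))) ^ 2 = 2 * L * (x / y) ^ 2 := by
  rw [div_pow, mul_pow, mul_pow, Real.sq_sqrt (by positivity), div_pow]
  field_simp

theorem not_solvable_of_lt (k : ℕ → ℕ) (muhat sigmahat γ : ℕ → ℝ)
    (hk : ∀ᶠ N in atTop, 2 ≤ k N ∧ k N < N)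
    (hmu : ∀ N, 0 < muhat N) (hsigma : ∀ N, 0 < sigmahat N)
    (hγ : ∀ N, γ N = muhat N / sigmahat N)
    (h : ∀ᶠ N in atTop, γ N < Real.sqrt (1 / ((k N : ℝ) - 1))) :
    ¬ Solvable muhat sigmahat k := by
  rintro ⟨f, hf, hlim⟩
  have hc := gaussianTail_pos
  have hlim' := (ENNReal.tendsto_toReal ENNReal.one_ne_top).comp hlim
  rw [ENNReal.toReal_one] at hlim'
  have hlog : Tendsto (fun N : ℕ => Real.log N) atTop atTop :=
    Real.tendsto_log_atTop.comp tendsto_natCast_atTop_atTop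
  -- Chosen so that `log N + 1 - a ≤ log (gaussianTail / 4 * N)` as soon as `a ≥ b`.
  set b := 1 - Real.log (gaussianTail / 4) with hb
  have hlogN : ∀ᶠ N : ℕ in atTop, Real.log N ≤ N / 2 - 1 := by
    have h1 := (Real.isLittleO_log_id_atTop.comp_tendsto
      (tendsto_natCast_atTop_atTop (R := ℝ))).bound (by norm_num : (0 : ℝ) < 1 / 4)
    filter_upwards [h1, eventually_ge_atTop 4] with N hN hN4
    have hN4' : (4 : ℝ) ≤ N := by exact_mod_cast hN4
    simp only [Function.comp, id, Real.norm_eq_abs] at hN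
    rw [abs_of_nonneg (by linarith : (0 : ℝ) ≤ N)] at hN
    have := le_abs_self (Real.log N)
    linarith
  have hev : ∀ᶠ N : ℕ in atTop,
      (law (muhat N * Real.log N) (sigmahat N * Real.sqrt (Real.log N / 2)) N (k N)
        {p | p.1 = f N p.2}).toReal ≤ 1 - gaussianTail / 2 := by
    filter_upwards [hk, h, hlogN, hlog.eventually_ge_atTop (b ^ 2 / 2 + b),
      eventually_ge_atTop 2] with N ⟨hk2, hkN⟩ hγN hN1 hN2 hN3
    have hN3' : (2 : ℝ) ≤ N := by exact_mod_cast hN3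
    have hk2' : (2 : ℝ) ≤ k N := by exact_mod_cast hk2
    have hkN' : (k N : ℝ) + 1 ≤ N := by exact_mod_cast hkN
    have hL : 0 < Real.log N := Real.log_pos (by linarith)
    have hm := mul_pos (hmu N) hL
    have hσ : 0 < sigmahat N * Real.sqrt (Real.log N / 2) :=
      mul_pos (hsigma N) (Real.sqrt_pos.2 (by positivity))
    have hratio : (muhat N * Real.log N / (sigmahat N * Real.sqrt (Real.log N / 2))) ^ 2 =
        2 * Real.log N * γ N ^ 2 := by rw [sq_scaled_ratio hL, hγ]
    have hγ0 : 0 < γ N := by rw [hγ]; exact div_pos (hmu N) (hsigma N)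
    have hγ1 : ((k N : ℝ) - 1) * γ N ^ 2 < 1 := by
      have h1 : γ N ^ 2 < 1 / ((k N : ℝ) - 1) := (Real.lt_sqrt hγ0.le).1 hγN
      rw [lt_div_iff₀ (by linarith)] at h1
      linarith
    -- For `a ≥ b` the term `-a` absorbs the constants; for `a ≤ b` the exponent stays bounded while
    -- `log N` grows. The slack `+ 2` is needed when a node is added.
    have key : ∀ a : ℝ, 0 < a → a ^ 2 ≤ 2 * Real.log N + 2 →
        Real.exp (a ^ 2 / 2 - a) ≤ gaussianTail / 4 * N := by
      intro a ha0 ha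
      rw [← Real.le_log_iff_exp_le (by positivity),
        Real.log_mul (by positivity) (by positivity)]
      rcases le_total b a with hab | hab
      · linarith
      · have : a ^ 2 ≤ b ^ 2 := by gcongr
        linarith
    rcases le_total (2 * k N) N with h2 | h2
    · have h2' : 2 * (k N : ℝ) ≤ N := by exact_mod_cast h2
      have hpos : 0 < ((k N : ℝ) - 1) * (2 * Real.log N * γ N ^ 2) :=
        mul_pos (by linarith) (by positivity)
      refine (success_le_of_small hk2 hkN hm hσ (hf N) (Real.sqrt_pos.2 hpos)
        (by rw [Real.sq_sqrt hpos.le, hratio])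
        (key _ (Real.sqrt_pos.2 hpos) ?_)).trans ?_
      · rw [Real.sq_sqrt hpos.le]
        nlinarith
      · have : gaussianTail / 4 * N / (N - k N + 1) ≤ gaussianTail / 2 := by
          rw [div_le_iff₀ (by linarith)]
          nlinarith
        linarith
    · have h2' : (N : ℝ) ≤ 2 * k N := by exact_mod_cast h2
      have hpos : 0 < (k N : ℝ) * (2 * Real.log N * γ N ^ 2) := by positivity
      refine (success_le_of_large hk2 hkN hm hσ (hf N) (Real.sqrt_pos.2 hpos)
        (by rw [Real.sq_sqrt hpos.le, hratio])
        (key _ (Real.sqrt_pos.2 hpos) ?_)).trans ?_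
      · rw [Real.sq_sqrt hpos.le]
        -- Adding a node changes `k` edges rather than `k - 1`. The extra edge costs `2 log N γ ^ 2
        -- ≤ 2`, because `log N ≤ N / 2 - 1 ≤ k - 1` here.
        have h3 : Real.log N * γ N ^ 2 ≤ 1 :=
          (mul_le_mul_of_nonneg_right (by linarith : Real.log N ≤ (k N : ℝ) - 1)
            (sq_nonneg _)).trans hγ1.le
        nlinarith
      · have : gaussianTail / 4 * N / (k N + 1) ≤ gaussianTail / 2 := by
          rw [div_le_iff₀ (by linarith)]
          nlinarith
        linarith
  have := le_of_tendsto hlim' hev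
  linarith

/-! ### Recovery by the heaviest set: tails, counting and union bound. -/

theorem map_sum_weightLaw {N : ℕ} (m σ : ℝ) (S : Finset (Fin N)) (F : Finset (Edge N)) :
    (weightLaw m σ N S).map (fun E => ∑ e ∈ F, E e) =
      gaussianReal (∑ e ∈ F, if e ∈ edgesIn S then m else 0)
        (Real.toNNReal (σ ^ 2 * F.card)) := by
  have h := map_sum_mul_pi_gaussianReal
    (fun e : Edge N => if ∀ v ∈ (e : Sym2 (Fin N)), v ∈ S then m else 0)
    (fun e => if e ∈ F then 1 else 0) (Real.toNNReal (σ ^ 2))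
  simp only [ite_mul, one_mul, zero_mul, Finset.sum_ite_mem, Finset.univ_inter, ite_pow, one_pow,
    ne_eq, OfNat.ofNat_ne_zero, not_false_eq_true, zero_pow, Finset.sum_const, nsmul_eq_mul,
    mul_one, Real.coe_toNNReal _ (sq_nonneg σ)] at h
  simp only [mem_edgesIn]
  exact h

theorem weightLaw_real_sum_le {N : ℕ} (m : ℝ) {σ s : ℝ} (hσ : 0 < σ) (hs : 0 ≤ s)
    {S : Finset (Fin N)} {F : Finset (Edge N)} (hF : F ⊆ edgesIn S) (hF0 : F.Nonempty) :
    (weightLaw m σ N S).real {E | ∑ e ∈ F, E e ≤ F.card * m - s} ≤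
      Real.exp (-s ^ 2 / (2 * (σ ^ 2 * F.card))) := by
  have hc : (0 : ℝ) < F.card := by exact_mod_cast hF0.card_pos
  have hv : Real.toNNReal (σ ^ 2 * F.card) ≠ 0 := by
    simp only [ne_eq, Real.toNNReal_eq_zero, not_le]; positivity
  have h := gaussianReal_real_Iic_sub_le (F.card * m) s hs hv
  have e : ∑ e ∈ F, (if e ∈ edgesIn S then m else 0) = F.card * m := by
    rw [Finset.sum_congr rfl fun e he => if_pos (hF he), Finset.sum_const, nsmul_eq_mul]
  have hmap := map_sum_weightLaw m σ S F
  rw [e] at hmap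
  rw [← hmap, map_measureReal_apply (by fun_prop) measurableSet_Iic,
    Real.coe_toNNReal _ (by positivity)] at h
  exact h

theorem weightLaw_real_le_sum {N : ℕ} (m : ℝ) {σ s : ℝ} (hσ : 0 < σ) (hs : 0 ≤ s)
    {S : Finset (Fin N)} {F : Finset (Edge N)} (hF : ∀ e ∈ F, e ∉ edgesIn S)
    (hF0 : F.Nonempty) :
    (weightLaw m σ N S).real {E | s ≤ ∑ e ∈ F, E e} ≤
      Real.exp (-s ^ 2 / (2 * (σ ^ 2 * F.card))) := by
  have hc : (0 : ℝ) < F.card := by exact_mod_cast hF0.card_pos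
  have hv : Real.toNNReal (σ ^ 2 * F.card) ≠ 0 := by
    simp only [ne_eq, Real.toNNReal_eq_zero, not_le]; positivity
  have h := gaussianReal_real_Ici_add_le 0 s hs hv
  have e : ∑ e ∈ F, (if e ∈ edgesIn S then m else 0) = 0 :=
    Finset.sum_eq_zero fun e he => if_neg (hF e he)
  have hmap := map_sum_weightLaw m σ S F
  rw [e] at hmap
  rw [← hmap, map_measureReal_apply (by fun_prop) measurableSet_Ici,
    Real.coe_toNNReal _ (by positivity), zero_add] at h
  exact h

theorem card_edgesIn_sdiff_inter {N k : ℕ} {S S' : Finset (Fin N)} (hS : S.card = k) :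
    ((edgesIn S \ edgesIn (S ∩ S')).card : ℝ) =
      (S \ S').card * (2 * k - (S \ S').card - 1) / 2 := by
  have h1 : ((S ∩ S').card : ℝ) = k - (S \ S').card := by
    have := Finset.card_inter_add_card_sdiff S S'
    rw [hS] at this
    have h2 := congrArg (Nat.cast (R := ℝ)) this
    push_cast at h2
    linarith
  rw [Finset.cast_card_sdiff (edgesIn_mono Finset.inter_subset_left), card_edgesIn, card_edgesIn,
    Nat.cast_choose_two, Nat.cast_choose_two, h1, hS]
  ring

/-- With `d = |S \ S'|` the exact count is `d (2 k - d - 1) / 2`, and `d ≤ k`. A bound linear in `d`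
makes the union bound a binomial sum. -/
theorem le_card_edgesIn_sdiff_inter {N k : ℕ} {S S' : Finset (Fin N)} (hS : S.card = k) :
    ((S \ S').card : ℝ) * (k - 1) / 2 ≤ (edgesIn S \ edgesIn (S ∩ S')).card := by
  have h1 : ((S \ S').card : ℝ) ≤ k := by
    exact_mod_cast (Finset.card_le_card Finset.sdiff_subset).trans hS.le
  rw [card_edgesIn_sdiff_inter hS]
  have h0 : (0 : ℝ) ≤ (S \ S').card := by positivity
  nlinarith

/-- The weightings for which `S` is the unique heaviest set of `k` nodes. -/
def uniqueHeaviest (N k : ℕ) (S : Finset (Fin N)) : Set (Weights N) :=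
  {E | S.card = k ∧ ∀ S' : Finset (Fin N), S'.card = k → S' ≠ S →
    ∑ e ∈ edgesIn S', E e < ∑ e ∈ edgesIn S, E e}

theorem measurableSet_uniqueHeaviest (N k : ℕ) (S : Finset (Fin N)) :
    MeasurableSet (uniqueHeaviest N k S) := by
  have e : uniqueHeaviest N k S = {_E | S.card = k} ∩ ⋂ S' : Finset (Fin N), ⋂ _ : S'.card = k,
      ⋂ _ : S' ≠ S, {E | ∑ e ∈ edgesIn S', E e < ∑ e ∈ edgesIn S, E e} := by
    ext E
    simp [uniqueHeaviest]
  rw [e]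
  refine (MeasurableSet.const _).inter ?_
  exact MeasurableSet.iInter fun S' => MeasurableSet.iInter fun _ => MeasurableSet.iInter fun _ =>
    measurableSet_lt (by fun_prop) (by fun_prop)

/-- The events for distinct `S` are disjoint, so the estimator can be defined piecewise, with no
rule for ties. -/
theorem exists_measurable_uniqueHeaviest (N k : ℕ) :
    ∃ f : Weights N → Finset (Fin N), Measurable f ∧
      ∀ S, ∀ E ∈ uniqueHeaviest N k S, f E = S := by
  obtain ⟨f, hf, h⟩ := exists_measurable_piecewise (uniqueHeaviest N k)
    (measurableSet_uniqueHeaviest N k) (fun S _ => S) (fun _ => measurable_const) (by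
      intro S S' hne E hE
      exact absurd (hE.1.2 S' hE.2.1 hne.symm) (hE.2.2 S hE.1.1 hne).not_gt)
  exact ⟨f, hf, fun S E hE => h S hE⟩

theorem sum_pow_card_erase_empty {α : Type*} [DecidableEq α] (S : Finset α) (r : ℝ) :
    ∑ D ∈ S.powerset.erase ∅, r ^ D.card = (1 + r) ^ S.card - 1 := by
  have h := Finset.sum_pow_mul_eq_add_pow r 1 S
  simp only [one_pow, mul_one] at h
  rw [← Finset.add_sum_erase _ _ (Finset.empty_mem_powerset S), Finset.card_empty, pow_zero] at h
  rw [add_comm 1 r, ← h]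
  ring

/-- Group the `S'` by `D = S \ S'`. Given `D`, the set `S'` is determined by `S' \ S`, which has
`|D|` elements, so there are at most `N ^ |D|` choices. -/
theorem sum_pow_card_sdiff_le {N k : ℕ} {S : Finset (Fin N)} (hS : S.card = k) {s : ℝ}
    (hs : 0 ≤ s) :
    ∑ S' ∈ (Finset.powersetCard k (Finset.univ : Finset (Fin N))).erase S, s ^ (S \ S').card ≤
      (1 + N * s) ^ k - 1 := by
  have hmaps : ∀ S' ∈ (Finset.powersetCard k (Finset.univ : Finset (Fin N))).erase S,
      S \ S' ∈ S.powerset.erase ∅ := by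
    intro S' hS'
    simp only [Finset.mem_erase, Finset.mem_powersetCard, Finset.subset_univ, true_and] at hS'
    simp only [Finset.mem_erase, Finset.mem_powerset, Finset.sdiff_subset, and_true, ne_eq,
      Finset.sdiff_eq_empty_iff_subset]
    exact fun h => hS'.1 (Finset.eq_of_subset_of_card_le h (by omega)).symm
  rw [← Finset.sum_fiberwise_of_maps_to hmaps, ← hS, ← sum_pow_card_erase_empty]
  refine Finset.sum_le_sum fun D _ => ?_
  have e : ∀ S' ∈ ((Finset.powersetCard S.card (Finset.univ : Finset (Fin N))).erase S).filter
      (fun S' => S \ S' = D), s ^ (S \ S').card = s ^ D.card := by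
    intro S' hS'
    rw [(Finset.mem_filter.1 hS').2]
  rw [Finset.sum_congr rfl e, Finset.sum_const, nsmul_eq_mul, mul_pow]
  refine mul_le_mul_of_nonneg_right ?_ (by positivity)
  have hcard : (((Finset.powersetCard S.card (Finset.univ : Finset (Fin N))).erase S).filter
      (fun S' => S \ S' = D)).card ≤
      (Finset.powersetCard D.card (Finset.univ : Finset (Fin N))).card := by
    refine Finset.card_le_card_of_injOn (fun S' => S' \ S) ?_ ?_
    · intro S' hS'
      simp only [Finset.coe_filter, Finset.mem_erase, Finset.mem_powersetCard, Finset.subset_univ,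
        true_and, Set.mem_ofPred_eq] at hS'
      simp only [Finset.mem_coe, Finset.mem_powersetCard,
        Finset.subset_univ, true_and]
      rw [← hS'.2]
      exact Finset.card_sdiff_comm hS'.1.2
    · intro S₁ h₁ S₂ h₂ h12
      simp only [Finset.coe_filter, Finset.mem_erase, Finset.mem_powersetCard, Finset.subset_univ,
        true_and, Set.mem_ofPred_eq] at h₁ h₂
      have h3 := h₁.2.trans h₂.2.symm
      ext i
      have h4 := Finset.ext_iff.1 h12 i
      have h5 := Finset.ext_iff.1 h3 i
      simp only [Finset.mem_sdiff] at h4 h5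
      tauto
  rw [Finset.card_powersetCard, Finset.card_univ, Fintype.card_fin] at hcard
  exact_mod_cast hcard.trans (Nat.choose_le_pow N D.card)

theorem weightLaw_real_compl_uniqueHeaviest_le {N k : ℕ} (hk : 2 ≤ k) {m σ : ℝ} (hm : 0 < m)
    (hσ : 0 < σ) {S : Finset (Fin N)} (hS : S.card = k) :
    (weightLaw m σ N S).real (uniqueHeaviest N k S)ᶜ ≤
      ((1 + Real.exp (-(((k : ℝ) - 1) * (m / σ) ^ 2 / 64))) ^ k - 1) +
      ((1 + N * Real.exp (-(9 * (((k : ℝ) - 1) * (m / σ) ^ 2 / 64)))) ^ k - 1) := by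
  have hk' : (2 : ℝ) ≤ k := by exact_mod_cast hk
  set q := ((k : ℝ) - 1) * (m / σ) ^ 2 / 64 with hq
  set P := weightLaw m σ N S with hP
  -- `A` is indexed by the lost nodes `D` alone, `B` by the competitor `S'`. The cut at `3/4` leaves
  -- deviations `n m / 4` and `3 n m / 4`, whence exponents in ratio `1 : 9`.
  let A : Finset (Fin N) → Set (Weights N) := fun D =>
    {E | ∑ e ∈ edgesIn S \ edgesIn (S \ D), E e ≤ 3 / 4 * (edgesIn S \ edgesIn (S \ D)).card * m}
  let B : Finset (Fin N) → Set (Weights N) := fun S' =>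
    {E | 3 / 4 * (edgesIn S' \ edgesIn (S ∩ S')).card * m ≤
      ∑ e ∈ edgesIn S' \ edgesIn (S ∩ S'), E e}
  have hcardeq : ∀ S' : Finset (Fin N), S'.card = k →
      (edgesIn S' \ edgesIn (S ∩ S')).card = (edgesIn S \ edgesIn (S ∩ S')).card := by
    intro S' hS'
    rw [Finset.card_sdiff_of_subset (edgesIn_mono Finset.inter_subset_right),
      Finset.card_sdiff_of_subset (edgesIn_mono Finset.inter_subset_left), card_edgesIn,
      card_edgesIn S, hS, hS']
  have hsub : (uniqueHeaviest N k S)ᶜ ⊆ (⋃ D ∈ S.powerset.erase ∅, A D) ∪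
      ⋃ S' ∈ (Finset.powersetCard k (Finset.univ : Finset (Fin N))).erase S, B S' := by
    intro E hE
    simp only [uniqueHeaviest, Set.mem_compl_iff, Set.mem_ofPred_eq, hS, true_and, not_forall,
      not_lt] at hE
    obtain ⟨S', hS', hne, hle⟩ := hE
    rw [← Finset.sum_sdiff (edgesIn_mono (Finset.inter_subset_left (s₁ := S) (s₂ := S'))),
      ← Finset.sum_sdiff (edgesIn_mono (Finset.inter_subset_right (s₁ := S) (s₂ := S')))] at hle
    have hle' := le_of_add_le_add_right hle
    by_cases h : ∑ e ∈ edgesIn S \ edgesIn (S ∩ S'), E e ≤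
        3 / 4 * (edgesIn S \ edgesIn (S ∩ S')).card * m
    · left
      refine Set.mem_biUnion (x := S \ S') ?_ ?_
      · simp only [Finset.coe_erase, Set.mem_sdiff, Finset.mem_coe, Finset.mem_powerset,
          Finset.sdiff_subset, true_and, Set.mem_singleton_iff, Finset.sdiff_eq_empty_iff_subset]
        exact fun h => hne (Finset.eq_of_subset_of_card_le h (by omega)).symm
      · simpa only [A, sdiff_sdiff_right_self, Finset.inf_eq_inter, Set.mem_ofPred_eq] using h
    · right
      refine Set.mem_biUnion (x := S') ?_ ?_
      · simp [hne, hS']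
      · simp only [B, Set.mem_ofPred_eq, hcardeq S' hS']
        linarith
  have hlow : ∀ S' : Finset (Fin N), (S \ S').Nonempty →
      0 < ((edgesIn S \ edgesIn (S ∩ S')).card : ℝ) := by
    intro S' hS'
    have h0 : (0 : ℝ) < (S \ S').card := by exact_mod_cast hS'.card_pos
    refine lt_of_lt_of_le ?_ (le_card_edgesIn_sdiff_inter hS)
    have : 0 < (k : ℝ) - 1 := by linarith
    positivity
  -- The deviation `n m / 4` has exponent `n (m / σ) ^ 2 / 32`, and `n ≥ |S \ S'| (k - 1) / 2`
  -- accounts for the 64 in `q`.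
  have hq2 : ∀ S' : Finset (Fin N), (S \ S').card * q ≤
      (edgesIn S \ edgesIn (S ∩ S')).card * (m / σ) ^ 2 / 32 := by
    intro S'
    have := mul_le_mul_of_nonneg_right (le_card_edgesIn_sdiff_inter (S' := S') hS)
      (sq_nonneg (m / σ))
    rw [hq]
    linarith
  have hA : ∀ D ∈ S.powerset.erase ∅, P.real (A D) ≤ Real.exp (-q) ^ D.card := by
    intro D hD
    rw [Finset.mem_erase, Finset.mem_powerset] at hD
    have hD1 : S \ (S \ D) = D := by
      rw [sdiff_sdiff_right_self, Finset.inf_eq_inter, Finset.inter_eq_right.2 hD.2]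
    have hD2 : S ∩ (S \ D) = S \ D := Finset.inter_eq_right.2 Finset.sdiff_subset
    have hpos := hlow (S \ D) (by rw [hD1]; exact Finset.nonempty_iff_ne_empty.2 hD.1)
    have hqq := hq2 (S \ D)
    rw [hD1] at hqq
    rw [hD2] at hpos hqq
    have hmain := weightLaw_real_sum_le m hσ
      (s := (edgesIn S \ edgesIn (S \ D)).card * m / 4) (by positivity)
      (S := S) (F := edgesIn S \ edgesIn (S \ D)) Finset.sdiff_subset
      (Finset.card_pos.1 (by exact_mod_cast hpos))
    set n := ((edgesIn S \ edgesIn (S \ D)).card : ℝ) with hn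
    have e1 : n * m - n * m / 4 = 3 / 4 * n * m := by ring
    rw [e1] at hmain
    refine hmain.trans ?_
    rw [← Real.exp_nat_mul, Real.exp_le_exp]
    have e2 : -(n * m / 4) ^ 2 / (2 * (σ ^ 2 * n)) = -(n * (m / σ) ^ 2 / 32) := by
      field_simp
      ring
    rw [e2]
    linarith
  have hB : ∀ S' ∈ (Finset.powersetCard k (Finset.univ : Finset (Fin N))).erase S,
      P.real (B S') ≤ Real.exp (-(9 * q)) ^ (S \ S').card := by
    intro S' hS'
    simp only [Finset.mem_erase, Finset.mem_powersetCard, Finset.subset_univ, true_and] at hS'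
    have hne : (S \ S').Nonempty := by
      rw [Finset.nonempty_iff_ne_empty, ne_eq, Finset.sdiff_eq_empty_iff_subset]
      exact fun h => hS'.1 (Finset.eq_of_subset_of_card_le h (by omega)).symm
    have hpos := hlow S' hne
    have hqq := hq2 S'
    rw [← hcardeq S' hS'.2] at hpos hqq
    have hmain := weightLaw_real_le_sum m hσ
      (s := 3 / 4 * (edgesIn S' \ edgesIn (S ∩ S')).card * m) (by positivity)
      (S := S) (F := edgesIn S' \ edgesIn (S ∩ S')) (by
        intro e he heS
        rw [edgesIn_inter, Finset.mem_sdiff, Finset.mem_inter] at he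
        exact he.2 ⟨heS, he.1⟩)
      (Finset.card_pos.1 (by exact_mod_cast hpos))
    refine hmain.trans ?_
    set n := ((edgesIn S' \ edgesIn (S ∩ S')).card : ℝ) with hn
    rw [← Real.exp_nat_mul, Real.exp_le_exp]
    have e2 : -(3 / 4 * n * m) ^ 2 / (2 * (σ ^ 2 * n)) = -(9 * (n * (m / σ) ^ 2 / 32)) := by
      field_simp
      ring
    rw [e2]
    linarith
  refine (measureReal_mono hsub).trans ((measureReal_union_le _ _).trans (add_le_add ?_ ?_))
  · rw [show (1 + Real.exp (-q)) ^ k - 1 = ∑ D ∈ S.powerset.erase ∅, Real.exp (-q) ^ D.card by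
      rw [sum_pow_card_erase_empty, hS]]
    exact (measureReal_biUnion_finset_le _ _).trans (Finset.sum_le_sum hA)
  · exact (measureReal_biUnion_finset_le _ _).trans
      ((Finset.sum_le_sum hB).trans (sum_pow_card_sdiff_le hS (Real.exp_pos _).le))

/-! ### From the failure bound to the regimes of `k`. -/

theorem law_success_ne_top {μ σ : ℝ} {N k : ℕ} {f : Weights N → Finset (Fin N)}
    (hf : Measurable f) : law μ σ N k {p | p.1 = f p.2} ≠ ⊤ := by
  rw [law_success hf, ENNReal.sum_ne_top]
  intro S hS
  have h : N.choose k ≠ 0 := by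
    have := Finset.card_pos.2 ⟨S, hS⟩
    rw [Finset.card_powersetCard, Finset.card_univ, Fintype.card_fin] at this
    omega
  have : (N.choose k : ENNReal)⁻¹ ≠ ⊤ := by simpa using h
  finiteness

theorem solvable_of_tendsto (k : ℕ → ℕ) (muhat sigmahat γ : ℕ → ℝ)
    (hk : ∀ᶠ N in atTop, 2 ≤ k N ∧ k N < N)
    (hmu : ∀ N, 0 < muhat N) (hsigma : ∀ N, 0 < sigmahat N)
    (hγ : ∀ N, γ N = muhat N / sigmahat N)
    (h1 : Tendsto (fun N : ℕ => k N *
      Real.exp (-(((k N : ℝ) - 1) * γ N ^ 2 * Real.log N / 32))) atTop (𝓝 0))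
    (h2 : Tendsto (fun N : ℕ => k N *
      (N * Real.exp (-(9 * (((k N : ℝ) - 1) * γ N ^ 2 * Real.log N / 32))))) atTop (𝓝 0)) :
    Solvable muhat sigmahat k := by
  choose f hf hfS using fun N => exists_measurable_uniqueHeaviest N (k N)
  refine ⟨f, hf, ?_⟩
  rw [← ENNReal.tendsto_toReal_iff (fun N => law_success_ne_top (hf N)) ENNReal.one_ne_top,
    ENNReal.toReal_one]
  have hexp : ∀ {u : ℕ → ℝ}, Tendsto u atTop (𝓝 0) →
      Tendsto (fun N => Real.exp (u N) - 1) atTop (𝓝 0) := by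
    intro u hu
    have := ((Real.continuous_exp.tendsto 0).comp hu).sub_const 1
    simpa using this
  have hlim : Tendsto (fun N : ℕ => 1 -
      ((Real.exp (k N * Real.exp (-(((k N : ℝ) - 1) * γ N ^ 2 * Real.log N / 32))) - 1) +
      (Real.exp (k N *
        (N * Real.exp (-(9 * (((k N : ℝ) - 1) * γ N ^ 2 * Real.log N / 32))))) - 1)))
      atTop (𝓝 1) := by
    have := ((hexp h1).add (hexp h2)).const_sub 1
    simpa using this
  refine tendsto_of_tendsto_of_tendsto_of_le_of_le' hlim tendsto_const_nhds ?_ ?_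
  · filter_upwards [hk, eventually_ge_atTop 2] with N ⟨hk2, hkN⟩ hN
    have hN' : (2 : ℝ) ≤ N := by exact_mod_cast hN
    have hL : 0 < Real.log N := Real.log_pos (by linarith)
    have hm := mul_pos (hmu N) hL
    have hσ : 0 < sigmahat N * Real.sqrt (Real.log N / 2) :=
      mul_pos (hsigma N) (Real.sqrt_pos.2 (by positivity))
    have hratio : (muhat N * Real.log N / (sigmahat N * Real.sqrt (Real.log N / 2))) ^ 2 =
        2 * Real.log N * γ N ^ 2 := by rw [sq_scaled_ratio hL, hγ]
    have hC : (0 : ℝ) < N.choose (k N) := by exact_mod_cast Nat.choose_pos hkN.le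
    have hpow : ∀ x : ℝ, 0 ≤ x → (1 + x) ^ k N ≤ Real.exp (k N * x) := by
      intro x hx
      rw [Real.exp_nat_mul]
      exact pow_le_pow_left₀ (by linarith) (by linarith [Real.add_one_le_exp x]) _
    rw [law_success_toReal (hf N), le_div_iff₀ hC]
    have hcard : ((Finset.powersetCard (k N) (Finset.univ : Finset (Fin N))).card : ℝ) =
        N.choose (k N) := by
      rw [Finset.card_powersetCard, Finset.card_univ, Fintype.card_fin]
    rw [← hcard, mul_comm, ← nsmul_eq_mul]
    refine Finset.card_nsmul_le_sum _ _ _ fun S hS => ?_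
    have hS' := (Finset.mem_powersetCard.1 hS).2
    have hb := weightLaw_real_compl_uniqueHeaviest_le hk2 hm hσ hS'
    rw [probReal_compl_eq_one_sub (measurableSet_uniqueHeaviest _ _ _), hratio,
      show ((k N : ℝ) - 1) * (2 * Real.log N * γ N ^ 2) / 64 =
        ((k N : ℝ) - 1) * γ N ^ 2 * Real.log N / 32 by ring] at hb
    have hmono : (weightLaw (muhat N * Real.log N) (sigmahat N * Real.sqrt (Real.log N / 2)) N
        S).real (uniqueHeaviest N (k N) S) ≤
        (weightLaw (muhat N * Real.log N) (sigmahat N * Real.sqrt (Real.log N / 2)) N S).real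
          (f N ⁻¹' {S}) := measureReal_mono fun E hE => hfS N S E hE
    have := hpow _ (Real.exp_pos (-(((k N : ℝ) - 1) * γ N ^ 2 * Real.log N / 32))).le
    have := hpow (N * Real.exp (-(9 * (((k N : ℝ) - 1) * γ N ^ 2 * Real.log N / 32))))
      (by positivity)
    linarith
  · refine Eventually.of_forall fun N => ?_
    rw [law_success_toReal (hf N)]
    refine div_le_one_of_le₀ ?_ (by positivity)
    refine (Finset.sum_le_card_nsmul _ _ 1 fun S _ => measureReal_le_one).trans (le_of_eq ?_)
    rw [Finset.card_powersetCard, Finset.card_univ, Fintype.card_fin, nsmul_eq_mul, mul_one]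

/-- When `(k - 1) γ ^ 2 ≥ 4`, both `exp (-q)` and `N exp (-9 q)` are at most `N ^ (-1/8)`, which
beats `k = O(log N)`. -/
theorem solvable_of_isBigO (k : ℕ → ℕ) (muhat sigmahat γ : ℕ → ℝ)
    (hk : ∀ᶠ N in atTop, 2 ≤ k N ∧ k N < N)
    (hmu : ∀ N, 0 < muhat N) (hsigma : ∀ N, 0 < sigmahat N)
    (hγ : ∀ N, γ N = muhat N / sigmahat N)
    (hO : (fun N => (k N : ℝ)) =O[atTop] fun N : ℕ => Real.log N)
    (h : ∀ᶠ N : ℕ in atTop, 4 * Real.log N ≤ ((k N : ℝ) - 1) * γ N ^ 2 * Real.log N) :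
    Solvable muhat sigmahat k := by
  have hlog : Tendsto (fun N : ℕ => Real.log N) atTop atTop :=
    Real.tendsto_log_atTop.comp tendsto_natCast_atTop_atTop
  have hlim : Tendsto (fun N : ℕ => k N * Real.exp (-(Real.log N / 8))) atTop (𝓝 0) := by
    have h1 : Tendsto (fun N : ℕ => Real.log N * Real.exp (-(Real.log N / 8))) atTop (𝓝 0) := by
      have h2 := ((Real.tendsto_pow_mul_exp_neg_atTop_nhds_zero 1).comp
        (hlog.atTop_div_const (by norm_num : (0 : ℝ) < 8))).const_mul 8
      rw [mul_zero] at h2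
      refine h2.congr fun N => ?_
      simp only [Function.comp, pow_one]
      ring
    exact (hO.mul (isBigO_refl _ _)).trans_tendsto h1
  refine solvable_of_tendsto k muhat sigmahat γ hk hmu hsigma hγ ?_ ?_
  · refine tendsto_of_tendsto_of_tendsto_of_le_of_le' tendsto_const_nhds hlim
      (Eventually.of_forall fun N => by positivity) ?_
    filter_upwards [h] with N hN
    refine mul_le_mul_of_nonneg_left (Real.exp_le_exp.2 ?_) (by positivity)
    linarith
  · refine tendsto_of_tendsto_of_tendsto_of_le_of_le' tendsto_const_nhds hlim
      (Eventually.of_forall fun N => by positivity) ?_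
    filter_upwards [h, eventually_ge_atTop 1] with N hN hN1
    have hN' : (0 : ℝ) < N := by exact_mod_cast hN1
    refine mul_le_mul_of_nonneg_left ?_ (by positivity)
    nth_rw 1 [← Real.exp_log hN']
    rw [← Real.exp_add, Real.exp_le_exp]
    linarith

/-- Here only `k ≤ N` is available; the constant 64 gives `q ≥ 2 log N`, so both error terms are at
most `1 / N`. -/
theorem solvable_of_le (k : ℕ → ℕ) (muhat sigmahat γ : ℕ → ℝ)
    (hk : ∀ᶠ N in atTop, 2 ≤ k N ∧ k N < N)
    (hmu : ∀ N, 0 < muhat N) (hsigma : ∀ N, 0 < sigmahat N)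
    (hγ : ∀ N, γ N = muhat N / sigmahat N)
    (h : ∀ᶠ N : ℕ in atTop, 64 * Real.log N ≤ ((k N : ℝ) - 1) * γ N ^ 2 * Real.log N) :
    Solvable muhat sigmahat k := by
  have hlim : Tendsto (fun N : ℕ => (N : ℝ)⁻¹) atTop (𝓝 0) :=
    tendsto_inv_atTop_zero.comp tendsto_natCast_atTop_atTop
  refine solvable_of_tendsto k muhat sigmahat γ hk hmu hsigma hγ ?_ ?_
  · refine tendsto_of_tendsto_of_tendsto_of_le_of_le' tendsto_const_nhds hlim
      (Eventually.of_forall fun N => by positivity) ?_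
    filter_upwards [h, hk] with N hN ⟨hk2, hkN⟩
    have hN' : (0 : ℝ) < N := by exact_mod_cast (by omega : 0 < N)
    have hkN' : (k N : ℝ) ≤ N := by exact_mod_cast hkN.le
    refine (mul_le_mul_of_nonneg_right hkN' (Real.exp_pos _).le).trans ?_
    nth_rw 1 [← Real.exp_log hN']
    rw [← Real.exp_log (inv_pos.2 hN'), Real.log_inv, ← Real.exp_add, Real.exp_le_exp]
    linarith
  · refine tendsto_of_tendsto_of_tendsto_of_le_of_le' tendsto_const_nhds hlim
      (Eventually.of_forall fun N => by positivity) ?_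
    filter_upwards [h, hk] with N hN ⟨hk2, hkN⟩
    have hN1 : (1 : ℝ) ≤ N := by exact_mod_cast (by omega : 1 ≤ N)
    have hN' : (0 : ℝ) < N := by linarith
    have hL : 0 ≤ Real.log N := Real.log_nonneg hN1
    have hkN' : (k N : ℝ) ≤ N := by exact_mod_cast hkN.le
    refine (mul_le_mul_of_nonneg_right hkN' (by positivity)).trans ?_
    have e : (N : ℝ) = Real.exp (Real.log N) := (Real.exp_log hN').symm
    rw [← Real.exp_log (inv_pos.2 hN'), Real.log_inv]
    calc (N : ℝ) * (N * Real.exp (-(9 * (((k N : ℝ) - 1) * γ N ^ 2 * Real.log N / 32))))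
        = Real.exp (Real.log N + (Real.log N +
            -(9 * (((k N : ℝ) - 1) * γ N ^ 2 * Real.log N / 32)))) := by
          rw [Real.exp_add, Real.exp_add, Real.exp_log hN']
      _ ≤ _ := by rw [Real.exp_le_exp]; linarith

theorem lt_sq_of_two_mul_sqrt_lt {x y : ℝ} (hx : 0 ≤ x) (h : 2 * Real.sqrt x < y) :
    4 * x < y ^ 2 := by
  have h1 := Real.sq_sqrt hx
  have h2 := Real.sqrt_nonneg x
  nlinarith

theorem solvable_of_tendsto_atTop (k : ℕ → ℕ) (muhat sigmahat γ : ℕ → ℝ)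
    (hk : ∀ᶠ N in atTop, 2 ≤ k N ∧ k N < N)
    (hmu : ∀ N, 0 < muhat N) (hsigma : ∀ N, 0 < sigmahat N)
    (hγ : ∀ N, γ N = muhat N / sigmahat N)
    (hlim : Tendsto (fun N : ℕ => (k N : ℝ) / Real.log N) atTop atTop)
    (h : ∀ᶠ N : ℕ in atTop, 2 * Real.sqrt ((1 + Real.log 2) / Real.log N) < γ N) :
    Solvable muhat sigmahat k := by
  have hlog : Tendsto (fun N : ℕ => Real.log N) atTop atTop :=
    Real.tendsto_log_atTop.comp tendsto_natCast_atTop_atTop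
  refine solvable_of_le k muhat sigmahat γ hk hmu hsigma hγ ?_
  -- `k ≥ 17 log N` and `log N ≥ 1` give `k - 1 ≥ 16 log N`; with `γ ^ 2 log N ≥ 4` this yields the
  -- constant 64.
  filter_upwards [h, hlim.eventually_ge_atTop 17, hlog.eventually_ge_atTop 1] with N h1 h2 h3
  have hL : 0 < Real.log N := by linarith
  have hl2 : 0 < Real.log 2 := Real.log_pos (by norm_num)
  have h4 := lt_sq_of_two_mul_sqrt_lt (by positivity) h1
  rw [le_div_iff₀ hL] at h2
  rw [← mul_div_assoc, div_lt_iff₀ hL] at h4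
  have h5 : (16 * Real.log N) * 4 ≤ ((k N : ℝ) - 1) * (γ N ^ 2 * Real.log N) :=
    mul_le_mul (by linarith) (by linarith) (by norm_num) (by linarith)
  linarith

theorem solvable_of_tendsto_const (k : ℕ → ℕ) (muhat sigmahat γ : ℕ → ℝ)
    (hk : ∀ᶠ N in atTop, 2 ≤ k N ∧ k N < N)
    (hmu : ∀ N, 0 < muhat N) (hsigma : ∀ N, 0 < sigmahat N)
    (hγ : ∀ N, γ N = muhat N / sigmahat N) {c : ℝ} (hc : 0 < c)
    (hlim : Tendsto (fun N : ℕ => (k N : ℝ) / Real.log N) atTop (𝓝 c))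
    (h : ∀ᶠ N : ℕ in atTop,
      2 * Real.sqrt ((1 + Real.log 2 + 1 / c) / Real.log N) < γ N) :
    Solvable muhat sigmahat k := by
  have hlog : Tendsto (fun N : ℕ => Real.log N) atTop atTop :=
    Real.tendsto_log_atTop.comp tendsto_natCast_atTop_atTop
  have hl2 : 0 < Real.log 2 := Real.log_pos (by norm_num)
  have hlim' : Tendsto (fun N : ℕ => ((k N : ℝ) - 1) / Real.log N) atTop (𝓝 c) := by
    have := hlim.sub (tendsto_inv_atTop_zero.comp hlog)
    rw [sub_zero] at this
    refine this.congr fun N => ?_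
    simp only [Function.comp, sub_div, one_div]
  -- Since `c (1 + log 2 + 1 / c) = 1 + c (1 + log 2) > 1`, the strict slack absorbs the passage to
  -- the limit and gives `(k - 1) γ ^ 2 ≥ 4` eventually.
  have hlt : 1 / (1 + Real.log 2 + 1 / c) < c := by
    rw [div_lt_iff₀ (by positivity)]
    have : c * (1 / c) = 1 := by field_simp
    nlinarith [mul_pos hc hl2]
  refine solvable_of_isBigO k muhat sigmahat γ hk hmu hsigma hγ ?_ ?_
  · refine isBigO_of_div_tendsto_nhds ?_ c hlim
    filter_upwards [hlog.eventually_gt_atTop 0] with N hN h0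
    exact absurd h0 hN.ne'
  · filter_upwards [h, hlim'.eventually_const_lt hlt, hlog.eventually_gt_atTop 0] with N h1 h2 hL
    have h4 := lt_sq_of_two_mul_sqrt_lt (by positivity) h1
    rw [← mul_div_assoc, div_lt_iff₀ hL] at h4
    have hpos : 0 < 1 + Real.log 2 + 1 / c := by positivity
    rw [div_lt_div_iff₀ hpos hL, one_mul] at h2
    have hk0 : 0 < (k N : ℝ) - 1 := by
      by_contra hneg
      nlinarith
    nlinarith

theorem solvable_of_isLittleO (k : ℕ → ℕ) (muhat sigmahat γ : ℕ → ℝ)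
    (hk : ∀ᶠ N in atTop, 2 ≤ k N ∧ k N < N)
    (hmu : ∀ N, 0 < muhat N) (hsigma : ∀ N, 0 < sigmahat N)
    (hγ : ∀ N, γ N = muhat N / sigmahat N)
    (ho : (fun N => (k N : ℝ)) =o[atTop] fun N : ℕ => Real.log N)
    (h : ∀ᶠ N in atTop, 2 * Real.sqrt (1 / ((k N : ℝ) - 1)) < γ N) :
    Solvable muhat sigmahat k := by
  refine solvable_of_isBigO k muhat sigmahat γ hk hmu hsigma hγ ho.isBigO ?_
  filter_upwards [h, hk, eventually_ge_atTop 1] with N h1 ⟨hk2, _⟩ hN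
  have hk2' : (2 : ℝ) ≤ k N := by exact_mod_cast hk2
  have hk1 : 0 < (k N : ℝ) - 1 := by linarith
  have hN' : (1 : ℝ) ≤ N := by exact_mod_cast hN
  have h4 := lt_sq_of_two_mul_sqrt_lt (by positivity) h1
  rw [← mul_div_assoc, mul_one, div_lt_iff₀ hk1] at h4
  exact mul_le_mul_of_nonneg_right (by linarith) (Real.log_nonneg hN')

end WSBM

theorem theorem5 (k : ℕ → ℕ) (muhat sigmahat γ : ℕ → ℝ)
    (hk : ∀ᶠ N in atTop, 2 ≤ k N ∧ k N < N)
    (hmu : ∀ N, 0 < muhat N) (hsigma : ∀ N, 0 < sigmahat N)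
    (hγ : ∀ N, γ N = muhat N / sigmahat N) :
    -- impossibility below the lower threshold
    ((∀ᶠ N in atTop, γ N < Real.sqrt (1 / ((k N : ℝ) - 1))) →
      ¬ WSBM.Solvable muhat sigmahat k) ∧
    -- `k = o(log N)`
    (((fun N => (k N : ℝ)) =o[atTop] fun N : ℕ => Real.log N) →
      (∀ᶠ N in atTop, 2 * Real.sqrt (1 / ((k N : ℝ) - 1)) < γ N) →
      WSBM.Solvable muhat sigmahat k) ∧
    -- `k / log N → c` with `0 < c < ∞`
    (∀ c : ℝ, 0 < c →
      Tendsto (fun N : ℕ => (k N : ℝ) / Real.log N) atTop (𝓝 c) →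
      (∀ᶠ N : ℕ in atTop,
        2 * Real.sqrt ((1 + Real.log 2 + 1 / c) / Real.log N) < γ N) →
      WSBM.Solvable muhat sigmahat k) ∧
    -- `k / log N → ∞` (so that `1 / c = 0`)
    (Tendsto (fun N : ℕ => (k N : ℝ) / Real.log N) atTop atTop →
      (∀ᶠ N : ℕ in atTop, 2 * Real.sqrt ((1 + Real.log 2) / Real.log N) < γ N) →
      WSBM.Solvable muhat sigmahat k) ∧
    -- `k / log N → ∞` and `k ≤ N ^ (α + o(1))` with `0 < α < 1`
    (∀ α : ℝ, 0 < α → α < 1 →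
      Tendsto (fun N : ℕ => (k N : ℝ) / Real.log N) atTop atTop →
      (∀ β : ℝ, α < β → ∀ᶠ N : ℕ in atTop, (k N : ℝ) ≤ (N : ℝ) ^ β) →
      (∀ᶠ N : ℕ in atTop,
        2 * Real.sqrt ((1 + Real.log 2) / ((1 - α) * Real.log N)) < γ N) →
      WSBM.Solvable muhat sigmahat k) := by
  refine ⟨WSBM.not_solvable_of_lt k muhat sigmahat γ hk hmu hsigma hγ,
    WSBM.solvable_of_isLittleO k muhat sigmahat γ hk hmu hsigma hγ,
    fun c hc => WSBM.solvable_of_tendsto_const k muhat sigmahat γ hk hmu hsigma hγ hc,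
    WSBM.solvable_of_tendsto_atTop k muhat sigmahat γ hk hmu hsigma hγ, ?_⟩
  intro α hα hα1 hlim _ h
  refine WSBM.solvable_of_tendsto_atTop k muhat sigmahat γ hk hmu hsigma hγ hlim ?_
  filter_upwards [h, eventually_ge_atTop 2] with N hN hN2
  have hN2' : (2 : ℝ) ≤ N := by exact_mod_cast hN2
  have hL : 0 < Real.log N := Real.log_pos (by linarith)
  have hl2 : 0 < Real.log 2 := Real.log_pos (by norm_num)
  have h1 : 0 < (1 - α) * Real.log N := mul_pos (by linarith) hL
  -- The factor `1 - α < 1` in the denominator only raises the threshold above that of the case `c =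
  -- ∞`.
  refine lt_of_le_of_lt ?_ hN
  gcongr
  nlinarith
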